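/- Let $n \ge 2$. Let $\mathbb H$ be the quaternions, let $\mathrm{Sp}(n)=\{A\in M_n(\mathbb H): A^*A=AA^*=I\}$, and let $\mathrm{PSp}(n)=\mathrm{Sp}(n)/\{\pm I\}$ with the quotient topology. Call a pair $(g_1,g_2)$ of elements of a group $G$ strongly doubly reversible if there is $h\in G$ with $h^2=1$, $hg_1h^{-1}=g_1^{-1}$ and $hg_2h^{-1}=g_2^{-1}$. Then the set of strongly doubly reversible pairs in $\mathrm{PSp}(n)$ has Haar measure zero in $\mathrm{PSp}(n)\times\mathrm{PSp}(n)$. -/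

import Mathlib

open scoped Quaternion Matrix

namespace QuaternionicUnitary

/-- The compact symplectic group `Sp(n)`: quaternionic `n × n` matrices `A` with
`A* A = A A* = I`, where `A*` is the conjugate transpose. It carries the topology induced
from the entrywise topology on matrices. -/
abbrev Sp (n : ℕ) : Type := unitary (Matrix (Fin n) (Fin n) ℍ)

/-- The subgroup `{I, -I}` of `Sp(n)`. -/
def plusMinusOne (n : ℕ) : Subgroup (Sp n) where
  carrier := {A | A = 1 ∨ A = -1}
  one_mem' := Or.inl rfl
  mul_mem' := by
    rintro a b (rfl | rfl) (rfl | rfl) <;> simp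
  inv_mem' := by
    rintro a (rfl | rfl)
    · simp
    · right
      rw [inv_eq_iff_mul_eq_one]
      simp

instance plusMinusOne_normal (n : ℕ) : (plusMinusOne n).Normal where
  conj_mem := by
    rintro a (rfl | rfl) g
    · left
      simp
    · right
      simp

/-- The projective group `PSp(n) = Sp(n) / {±I}`. -/
def PSp (n : ℕ) : Type := Sp n ⧸ plusMinusOne n

noncomputable instance (n : ℕ) : Group (PSp n) :=
  inferInstanceAs (Group (Sp n ⧸ plusMinusOne n))

/-- `PSp(n)` carries the quotient topology. -/
instance (n : ℕ) : TopologicalSpace (PSp n) :=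
  inferInstanceAs (TopologicalSpace (Sp n ⧸ plusMinusOne n))

/-- `PSp(n)` carries its Borel σ-algebra. -/
instance (n : ℕ) : MeasurableSpace (PSp n) := borel (PSp n)

instance (n : ℕ) : BorelSpace (PSp n) := ⟨rfl⟩

instance (n : ℕ) : IsTopologicalGroup (PSp n) :=
  inferInstanceAs (IsTopologicalGroup (Sp n ⧸ plusMinusOne n))

/-- `PSp(n)` is second countable, so the product σ-algebra on `PSp(n) × PSp(n)` is the Borel
σ-algebra of the product topology. -/
instance (n : ℕ) : SecondCountableTopology (PSp n) := by
  have : SecondCountableTopology ℍ :=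
    Quaternion.linearIsometryEquivTuple.toHomeomorph.secondCountableTopology
  have : SecondCountableTopology (Matrix (Fin n) (Fin n) ℍ) :=
    inferInstanceAs (SecondCountableTopology (Fin n → Fin n → ℍ))
  have : SecondCountableTopology (Sp n) :=
    TopologicalSpace.secondCountableTopology_induced _ (Matrix (Fin n) (Fin n) ℍ) Subtype.val
  exact (QuotientGroup.isQuotientMap_mk (N := plusMinusOne n)).secondCountableTopology
    QuotientGroup.isOpenMap_coe

/-- A pair `(g₁, g₂)` in a group is strongly doubly reversible if some `h` with `h² = 1`
simultaneously conjugates `(g₁, g₂)` to `(g₁⁻¹, g₂⁻¹)`. -/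
def IsStronglyDoublyReversible {G : Type*} [Group G] (g : G × G) : Prop :=
  ∃ h : G, h ^ 2 = 1 ∧ h * g.1 * h⁻¹ = g.1⁻¹ ∧ h * g.2 * h⁻¹ = g.2⁻¹

end QuaternionicUnitary

/-! The proof is a dimension count. If `h` is an involution inverting `g₁` and `g₂` by conjugation,
then `h * g₁` and `h * g₂` also square to `1`, so upstairs in `Sp n` the pair has the form `(x * y,
x * z)` with `x`, `y`, `z` squaring to `±1`. Near a point `h`, such square roots are controlled by
the skew-adjoint `X` anticommuting with `h`, a space of dimension at most `n(n+1)`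
(`finrank_skewAnticommutant_le`). Triples thus have Hausdorff dimension at most `3n(n+1)`, which is
below `dim Sp(n)² = 2n(2n+1)` exactly when `n ≥ 2`, and the smooth map `(x, y, z) ↦ (xy, xz)` cannot
raise dimension. No Haar measure is computed in charts: the exponential pulls every right translate
of the bad set back to a null set near `0`, and Fubini (`measure_eq_zero_of_forall_right_translate`)
transfers this to `μ`. -/

open MeasureTheory Set Filter Topology Module

/-! ### Hausdorff dimension and antilipschitz maps -/

section HausdorffDimension

/-- A set is of Hausdorff dimension at most `r` if it is so locally. -/
theorem dimH_le_of_forall_mem_nhdsWithin {X : Type*} [EMetricSpace X] [SecondCountableTopology X]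
    {s : Set X} {r : ENNReal} (h : ∀ x ∈ s, ∃ t ∈ 𝓝[s] x, dimH t ≤ r) : dimH s ≤ r := by
  by_contra! hlt
  obtain ⟨x, hx, hx'⟩ := exists_mem_nhdsWithin_lt_dimH_of_lt_dimH hlt
  obtain ⟨t, ht, hle⟩ := h x hx
  exact absurd (hx' t ht) (not_lt.2 hle)

/-- A map which is antilipschitz on `s` does not decrease the Hausdorff dimension of `s`. -/
theorem dimH_le_dimH_image_of_dist_le {X Y : Type*} [MetricSpace X] [MetricSpace Y] {s : Set X}
    {f : X → Y} {K : ℝ} (h : ∀ x ∈ s, ∀ y ∈ s, dist x y ≤ K * dist (f x) (f y)) :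
    dimH s ≤ dimH (f '' s) := by
  have hanti : AntilipschitzWith K.toNNReal (fun x : s => f x) := by
    refine AntilipschitzWith.of_le_mul_dist fun x y => (h x x.2 y y.2).trans ?_
    gcongr
    exact Real.le_coe_toNNReal K
  calc dimH s = dimH (Subtype.val '' (univ : Set s)) := by simp
    _ = dimH (univ : Set s) := isometry_subtype_coe.dimH_image _
    _ ≤ dimH ((fun x : s => f x) '' univ) := hanti.le_dimH_image _
    _ = dimH (f '' s) := by
      congr 1
      ext y
      simp

end HausdorffDimension

/-- The exponential map is antilipschitz near `0`. -/
theorem NormedSpace.exists_nhds_norm_sub_le_exp (R : Type*) [NormedRing R] [NormedAlgebra ℝ R]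
    [CompleteSpace R] :
    ∃ U ∈ 𝓝 (0 : R), ∀ a ∈ U, ∀ b ∈ U,
      ‖a - b‖ ≤ 2 * ‖NormedSpace.exp a - NormedSpace.exp b‖ := by
  have h := (hasStrictFDerivAt_exp_zero (𝕂 := ℝ) (𝔸 := R)).isLittleO.bound
    (show (0 : ℝ) < 1 / 2 by norm_num)
  rw [nhds_prod_eq, eventually_prod_self_iff'] at h
  obtain ⟨U, hU, H⟩ := h
  refine ⟨U, hU, fun a ha b hb => ?_⟩
  have h1 := H a ha b hb
  simp only [one_apply_eq_self] at h1
  have h2 : ‖a - b‖ ≤ ‖NormedSpace.exp a - NormedSpace.exp b‖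
      + ‖NormedSpace.exp a - NormedSpace.exp b - (a - b)‖ := by
    have := norm_sub_le (NormedSpace.exp a - NormedSpace.exp b)
      (NormedSpace.exp a - NormedSpace.exp b - (a - b))
    simpa using this
  linarith

/-! ### Unitary square roots of `±1` in a star algebra -/

namespace StarUnitary

variable {R : Type*} [NormedRing R] [StarRing R]

/-- The unitary elements whose square is `1` or `-1`. -/
def squareRoots (R : Type*) [Ring R] [StarRing R] : Set R :=
  {x | x ∈ unitary R ∧ (x * x = 1 ∨ x * x = -1)}

/-- The skew-adjoint elements anticommuting with `h`. -/
def skewAnticommutant {R : Type*} [Ring R] [Algebra ℝ R] [StarRing R] [StarModule ℝ R] (h : R) :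
    Submodule ℝ R where
  carrier := {X | star X = -X ∧ h * X = -(X * h)}
  add_mem' := by
    rintro a b ⟨ha, ha'⟩ ⟨hb, hb'⟩
    refine ⟨by rw [star_add, ha, hb, neg_add], by rw [mul_add, add_mul, ha', hb', neg_add]⟩
  zero_mem' := by simp
  smul_mem' := by
    rintro c a ⟨ha, ha'⟩
    refine ⟨by rw [star_smul, ha, star_trivial, smul_neg], ?_⟩
    rw [mul_smul_comm, ha', smul_mul_assoc, smul_neg]

/-- Close to the identity, a unitary element is a Lipschitz function of its skew part. -/
theorem norm_sub_le_of_mem_unitary [NormedAlgebra ℝ R] {u v : R} (hu : u ∈ unitary R)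
    (hv : v ∈ unitary R)
    (hu₁ : ‖u + star u - 2‖ ≤ 1) (hv₁ : ‖v + star v - 2‖ ≤ 1)
    (hu₂ : ‖u - star u‖ ≤ 1) (hv₂ : ‖v - star v‖ ≤ 1) :
    ‖u - v‖ ≤ ‖(u - star u) - (v - star v)‖ := by
  set δ := (u + star u) - (v + star v) with hδ
  set σ := (u - star u) - (v - star v) with hσ
  have h1 := Unitary.star_mul_self_of_mem hu
  have h2 := Unitary.mul_star_self_of_mem hu
  have h3 := Unitary.star_mul_self_of_mem hv
  have h4 := Unitary.mul_star_self_of_mem hv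
  -- Since `u` is unitary, `(u + u*)² - (u - u*)² = 4`, and likewise for `v`. Subtracting and
  -- expanding around `u + u* ≈ 2` bounds `δ` by `σ`.
  have key : (4 : ℝ) • δ = (u - star u) * σ + σ * (v - star v)
      - ((u + star u - 2) * δ + δ * (v + star v - 2)) := by
    have hc : (u + star u) * (u + star u) - (u - star u) * (u - star u) = 4 := by
      have : (u + star u) * (u + star u) - (u - star u) * (u - star u)
        = 2 * (u * star u) + 2 * (star u * u) := by noncomm_ring
      rw [this, h1, h2]; norm_num
    have hc' : (v + star v) * (v + star v) - (v - star v) * (v - star v) = 4 := by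
      have : (v + star v) * (v + star v) - (v - star v) * (v - star v)
        = 2 * (v * star v) + 2 * (star v * v) := by noncomm_ring
      rw [this, h3, h4]; norm_num
    have h4 : (4 : ℝ) • δ = 4 * δ := by
      rw [Algebra.smul_def, map_ofNat]
    rw [h4, ← sub_eq_zero]
    have : 4 * δ - ((u - star u) * σ + σ * (v - star v)
      - ((u + star u - 2) * δ + δ * (v + star v - 2))) =
      ((u + star u) * (u + star u) - (u - star u) * (u - star u)) -
      ((v + star v) * (v + star v) - (v - star v) * (v - star v)) := by
      rw [hδ, hσ]; noncomm_ring
    rw [this, hc, hc', sub_self]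
  have hle : 4 * ‖δ‖ ≤ 2 * ‖σ‖ + 2 * ‖δ‖ := by
    calc 4 * ‖δ‖ = ‖(4 : ℝ) • δ‖ := by rw [norm_smul]; norm_num
      _ ≤ ‖u - star u‖ * ‖σ‖ + ‖σ‖ * ‖v - star v‖
        + (‖u + star u - 2‖ * ‖δ‖ + ‖δ‖ * ‖v + star v - 2‖) := by
        rw [key]
        refine (norm_sub_le _ _).trans (add_le_add ((norm_add_le _ _).trans ?_)
          ((norm_add_le _ _).trans ?_)) <;>
        exact add_le_add (norm_mul_le _ _) (norm_mul_le _ _)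
      _ ≤ 1 * ‖σ‖ + ‖σ‖ * 1 + (1 * ‖δ‖ + ‖δ‖ * 1) := by gcongr
      _ = _ := by ring
  have h2 : ‖(2 : ℝ) • (u - v)‖ ≤ ‖δ‖ + ‖σ‖ := by
    have : (2 : ℝ) • (u - v) = δ + σ := by rw [two_smul, hδ, hσ]; abel
    rw [this]; exact norm_add_le _ _
  rw [norm_smul] at h2
  norm_num at h2
  linarith

theorem sigmaCompactSpace_unitary [NormedAlgebra ℝ R] [FiniteDimensional ℝ R]
    [ContinuousStar R] : SigmaCompactSpace (unitary R) := by
  have : ProperSpace R := FiniteDimensional.proper ℝ R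
  have h : IsClosed {A : R | star A * A = 1 ∧ A * star A = 1} :=
    (isClosed_eq (by fun_prop) continuous_const).inter (isClosed_eq (by fun_prop) continuous_const)
  exact h.sigmaCompactSpace

variable [NormedAlgebra ℝ R] [StarModule ℝ R]

/-- Equal squares make `h` and `y` both self-adjoint or both skew-adjoint, so the element is `±(hy -
yh)`; this anticommutes with `h` because `h²` is a central scalar. -/
theorem mem_skewAnticommutant {h y : R} (hh : h ∈ squareRoots R) (hy : y ∈ squareRoots R)
    (hsq : y * y = h * h) : star h * y - star y * h ∈ skewAnticommutant h := by
  refine ⟨by simp, ?_⟩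
  obtain ⟨hu, hs⟩ := hh
  obtain ⟨hyu, -⟩ := hy
  have h1 := Unitary.star_mul_self_of_mem hu
  have h2 := Unitary.mul_star_self_of_mem hu
  have h3 := Unitary.star_mul_self_of_mem hyu
  have h4 := Unitary.mul_star_self_of_mem hyu
  have hcases : (star h = h ∧ star y = y) ∨ (star h = -h ∧ star y = -y) := by
    rcases hs with hs | hs
    · left
      constructor
      · calc star h = star h * (h * h) := by rw [hs, mul_one]
          _ = h := by rw [← mul_assoc, h1, one_mul]
      · calc star y = star y * (y * y) := by rw [hsq, hs, mul_one]
          _ = y := by rw [← mul_assoc, h3, one_mul]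
    · right
      constructor
      · calc star h = -(star h * (h * h)) := by rw [hs]; simp
          _ = -h := by rw [← mul_assoc, h1, one_mul]
      · calc star y = -(star y * (y * y)) := by rw [hsq, hs]; simp
          _ = -y := by rw [← mul_assoc, h3, one_mul]
  rcases hcases with ⟨e1, e2⟩ | ⟨e1, e2⟩
  · rw [e1, e2]
    have a : h * h = 1 := by rw [← h1, e1]
    calc h * (h * y - y * h) = (h * h) * y - h * y * h := by noncomm_ring
      _ = y * (h * h) - h * y * h := by rw [a, one_mul, mul_one]
      _ = _ := by noncomm_ring
  · rw [e1, e2]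
    have a : h * h = -1 := by rw [← h1, e1]; simp
    calc h * (-h * y - -y * h) = -((h * h) * y) + h * y * h := by noncomm_ring
      _ = -(y * (h * h)) + h * y * h := by rw [a]; simp
      _ = _ := by noncomm_ring

variable [ContinuousStar R]

/-- Near each of its points, `squareRoots R` embeds into the space of skew-adjoint elements
anticommuting with that point, by an antilipschitz map. -/
theorem exists_antilipschitz_chart {h : R} (hh : h ∈ squareRoots R) :
    ∃ f : R → skewAnticommutant h, ∃ K : ℝ, ∃ U ∈ 𝓝 h, ∀ x ∈ squareRoots R ∩ U,
      ∀ y ∈ squareRoots R ∩ U, dist x y ≤ K * dist (f x) (f y) := by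
  classical
  let g : R → R := fun y => star h * y - star y * h
  have h1 := Unitary.star_mul_self_of_mem hh.1
  have h2 := Unitary.mul_star_self_of_mem hh.1
  -- The value `0` is junk, never used on square roots near `h`.
  let f : R → skewAnticommutant h := fun y =>
    if hy : g y ∈ skewAnticommutant h then ⟨g y, hy⟩ else 0
  have hsq : ∀ᶠ y in 𝓝 h, y ∈ squareRoots R → y * y = h * h := by
    -- If `1 = -1` in `R`, all squares agree; otherwise continuity keeps `y * y` away from the
    -- opposite sign.
    by_cases hR : h * h = -(h * h)
    · refine Eventually.of_forall fun y hy => ?_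
      rcases hh.2 with e | e <;> rcases hy.2 with e' | e' <;> rw [e] at hR ⊢ <;> rw [e'] <;>
        simpa using hR.symm
    · have hc : ∀ᶠ y in 𝓝 h, y * y ≠ -(h * h) :=
        (continuous_id.mul continuous_id).continuousAt.eventually_ne hR
      filter_upwards [hc] with y hy hyJ
      rcases hh.2 with e | e <;> rcases hyJ.2 with e' | e' <;> rw [e] at hy ⊢ <;> rw [e'] at hy ⊢ <;>
        simp at hy
  have c1 : ∀ᶠ y in 𝓝 h, ‖star h * y + star (star h * y) - 2‖ < 1 := by
    have : Continuous fun y : R => ‖star h * y + star (star h * y) - 2‖ := by fun_prop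
    refine this.continuousAt.eventually_lt continuousAt_const ?_
    rw [h1, star_one]; norm_num
  have c2 : ∀ᶠ y in 𝓝 h, ‖star h * y - star (star h * y)‖ < 1 := by
    have : Continuous fun y : R => ‖star h * y - star (star h * y)‖ := by fun_prop
    refine this.continuousAt.eventually_lt continuousAt_const ?_
    rw [h1, star_one]; norm_num
  refine ⟨f, ‖h‖, _, (hsq.and (c1.and c2)), ?_⟩
  rintro x ⟨hx, hx1, hx2, hx3⟩ y ⟨hy, hy1, hy2, hy3⟩
  have fx : (f x : R) = g x := by
    simp only [f]; rw [dif_pos (mem_skewAnticommutant hh hx (hx1 hx))]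
  have fy : (f y : R) = g y := by
    simp only [f]; rw [dif_pos (mem_skewAnticommutant hh hy (hy1 hy))]
  have hu := norm_sub_le_of_mem_unitary (mul_mem (Unitary.star_mem hh.1) hx.1)
    (mul_mem (Unitary.star_mem hh.1) hy.1) hx2.le hy2.le hx3.le hy3.le
  rw [Subtype.dist_eq, fx, fy, dist_eq_norm, dist_eq_norm]
  calc ‖x - y‖ = ‖h * (star h * x - star h * y)‖ := by
        rw [mul_sub, ← mul_assoc, ← mul_assoc, h2, one_mul, one_mul]
    _ ≤ ‖h‖ * ‖star h * x - star h * y‖ := norm_mul_le _ _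
    _ ≤ ‖h‖ * ‖g x - g y‖ := by
      gcongr
      refine hu.trans (le_of_eq ?_)
      simp [g]

variable [FiniteDimensional ℝ R]

theorem dimH_squareRoots_prod_le {k : ℕ}
    (hk : ∀ h ∈ squareRoots R, finrank ℝ (skewAnticommutant h) ≤ k) :
    dimH (squareRoots R ×ˢ squareRoots R ×ˢ squareRoots R) ≤ (3 * k : ℕ) := by
  have : ProperSpace R := FiniteDimensional.proper ℝ R
  refine dimH_le_of_forall_mem_nhdsWithin ?_
  rintro ⟨a, b, c⟩ ⟨ha, hb, hc⟩
  simp only at ha hb hc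
  obtain ⟨f₁, K₁, U₁, hU₁, H₁⟩ := exists_antilipschitz_chart ha
  obtain ⟨f₂, K₂, U₂, hU₂, H₂⟩ := exists_antilipschitz_chart hb
  obtain ⟨f₃, K₃, U₃, hU₃, H₃⟩ := exists_antilipschitz_chart hc
  refine ⟨(squareRoots R ×ˢ squareRoots R ×ˢ squareRoots R) ∩ (U₁ ×ˢ U₂ ×ˢ U₃),
    inter_mem_nhdsWithin _ (prod_mem_nhds hU₁ (prod_mem_nhds hU₂ hU₃)), ?_⟩
  let F : R × R × R → skewAnticommutant a × skewAnticommutant b × skewAnticommutant c :=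
    fun p => (f₁ p.1, f₂ p.2.1, f₃ p.2.2)
  refine (dimH_le_dimH_image_of_dist_le (f := F) (K := max |K₁| (max |K₂| |K₃|)) ?_).trans ?_
  · rintro ⟨x, y, z⟩ ⟨⟨hx, hy, hz⟩, hx', hy', hz'⟩ ⟨x₁, y₁, z₁⟩ ⟨⟨hx₁, hy₁, hz₁⟩, hx₁', hy₁', hz₁'⟩
    have e₁ := H₁ x ⟨hx, hx'⟩ x₁ ⟨hx₁, hx₁'⟩
    have e₂ := H₂ y ⟨hy, hy'⟩ y₁ ⟨hy₁, hy₁'⟩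
    have e₃ := H₃ z ⟨hz, hz'⟩ z₁ ⟨hz₁, hz₁'⟩
    simp only [Prod.dist_eq, F]
    refine max_le (e₁.trans ?_) (max_le (e₂.trans ?_) (e₃.trans ?_)) <;> gcongr
    · exact (le_abs_self _).trans (le_max_left _ _)
    · exact le_max_left _ _
    · exact (le_abs_self _).trans ((le_max_left _ _).trans (le_max_right _ _))
    · exact (le_max_left _ _).trans (le_max_right _ _)
    · exact (le_abs_self _).trans ((le_max_right _ _).trans (le_max_right _ _))
    · exact (le_max_right _ _).trans (le_max_right _ _)
  · refine (dimH_mono (subset_univ _)).trans ?_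
    rw [Real.dimH_univ_eq_finrank, finrank_prod, finrank_prod]
    have := hk a ha
    have := hk b hb
    have := hk c hc
    exact_mod_cast (by omega)

/-- The exponential map from skew-adjoint to unitary elements. -/
noncomputable def expSkewAdjoint (X : skewAdjoint.submodule ℝ R) : unitary R :=
  ⟨NormedSpace.exp (X : R), by
    have : CompleteSpace R := FiniteDimensional.complete ℝ R
    let +nondep : NormedAlgebra ℚ R := .restrictScalars ℚ ℝ R
    exact NormedSpace.exp_mem_unitary_of_mem_skewAdjoint X.2⟩

theorem continuous_expSkewAdjoint : Continuous (expSkewAdjoint (R := R)) := by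
  have : CompleteSpace R := FiniteDimensional.complete ℝ R
  let +nondep : NormedAlgebra ℚ R := .restrictScalars ℚ ℝ R
  exact (NormedSpace.exp_continuous.comp continuous_subtype_val).subtype_mk _

/-- `exp` is antilipschitz on `B`, so the set has dimension at most that of a smooth image of
triples of square roots. `B` is chosen before `a` and `b`, as Fubini needs one measure for all
translates. -/
theorem exists_nhds_hausdorffMeasure_exp_eq_zero
    [MeasurableSpace (skewAdjoint.submodule ℝ R)] [BorelSpace (skewAdjoint.submodule ℝ R)] {k : ℕ}
    (hk : ∀ h ∈ squareRoots R, finrank ℝ (skewAnticommutant h) ≤ k)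
    (hlt : 3 * k < 2 * finrank ℝ (skewAdjoint.submodule ℝ R)) :
    ∃ B ∈ 𝓝 (0 : skewAdjoint.submodule ℝ R × skewAdjoint.submodule ℝ R), ∀ a b : R,
      μH[finrank ℝ (skewAdjoint.submodule ℝ R × skewAdjoint.submodule ℝ R)]
        {X ∈ B | ∃ x ∈ squareRoots R, ∃ y ∈ squareRoots R, ∃ z ∈ squareRoots R,
          (expSkewAdjoint X.1 : R) = x * y * a ∧ (expSkewAdjoint X.2 : R) = x * z * b} = 0 := by
  have : CompleteSpace R := FiniteDimensional.complete ℝ R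
  obtain ⟨U, hU, H⟩ := NormedSpace.exists_nhds_norm_sub_le_exp R
  have hU' : (Subtype.val ⁻¹' U : Set (skewAdjoint.submodule ℝ R)) ∈ 𝓝 0 :=
    continuous_subtype_val.continuousAt.preimage_mem_nhds (by simpa using hU)
  refine ⟨(Subtype.val ⁻¹' U) ×ˢ (Subtype.val ⁻¹' U), prod_mem_nhds hU' hU', fun a b => ?_⟩
  let e : skewAdjoint.submodule ℝ R × skewAdjoint.submodule ℝ R → R × R :=
    fun X => (expSkewAdjoint X.1, expSkewAdjoint X.2)
  let F : R × R × R → R × R := fun p => (p.1 * p.2.1 * a, p.1 * p.2.2 * b)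
  have hF : ContDiff ℝ 1 F := by fun_prop
  refine hausdorffMeasure_of_dimH_lt (d := (finrank ℝ
    (skewAdjoint.submodule ℝ R × skewAdjoint.submodule ℝ R) : NNReal)) ?_
  refine lt_of_le_of_lt (b := ((3 * k : ℕ) : ENNReal)) ?_ ?_
  · refine (dimH_le_dimH_image_of_dist_le (f := e) (K := 2) ?_).trans ?_
    · rintro ⟨X, Y⟩ ⟨⟨hX, hY⟩, -⟩ ⟨X', Y'⟩ ⟨⟨hX', hY'⟩, -⟩
      have h1 := H _ hX _ hX'
      have h2 := H _ hY _ hY'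
      simp only [dist_eq_norm, e]
      refine max_le (h1.trans ?_) (h2.trans ?_) <;> gcongr
      · exact le_max_left _ _
      · exact le_max_right _ _
    · refine (dimH_mono ?_).trans ((ContDiffOn.dimH_image_le (f := F) (s := univ)
        hF.contDiffOn convex_univ (subset_univ
          (squareRoots R ×ˢ squareRoots R ×ˢ squareRoots R))).trans (dimH_squareRoots_prod_le hk))
      rintro _ ⟨X, ⟨-, x, hx, y, hy, z, hz, h1, h2⟩, rfl⟩
      exact ⟨(x, y, z), ⟨hx, hy, hz⟩, by simp [F, e, h1, h2]⟩
  · rw [finrank_prod]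
    exact_mod_cast (by omega)

end StarUnitary

/-! ### Traces of real-linear maps on quaternionic matrices -/

namespace LinearMap

/-- The trace of an endomorphism of a space of matrices, as a sum over the entries. -/
theorem trace_matrix_eq_sum {n E : Type*} [Fintype n] [DecidableEq n] [AddCommGroup E]
    [Module ℝ E] [FiniteDimensional ℝ E] (f : Matrix n n E →ₗ[ℝ] Matrix n n E) :
    LinearMap.trace ℝ _ f = ∑ i, ∑ j, LinearMap.trace ℝ E
      (Matrix.entryLinearMap ℝ E i j ∘ₗ f ∘ₗ Matrix.singleLinearMap ℝ i j) := by
  have hf : f = ∑ i, ∑ j, (f ∘ₗ Matrix.singleLinearMap ℝ i j) ∘ₗ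
      Matrix.entryLinearMap ℝ E i j := by
    ext X : 1
    conv_lhs => rw [Matrix.matrix_eq_sum_single X]
    simp [LinearMap.sum_apply]
  conv_lhs => rw [hf]
  simp only [map_sum]
  refine Finset.sum_congr rfl fun i _ => Finset.sum_congr rfl fun j _ => ?_
  rw [LinearMap.trace_comp_comm']

theorem trace_quaternionAlgebra {c₁ c₂ c₃ : ℝ} (g : ℍ[ℝ,c₁,c₂,c₃] →ₗ[ℝ] ℍ[ℝ,c₁,c₂,c₃]) :
    LinearMap.trace ℝ _ g = (g ⟨1, 0, 0, 0⟩).re + (g ⟨0, 1, 0, 0⟩).imI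
      + (g ⟨0, 0, 1, 0⟩).imJ + (g ⟨0, 0, 0, 1⟩).imK := by
  have hb (i : Fin 4) : QuaternionAlgebra.basisOneIJK c₁ c₂ c₃ i =
      ![⟨1, 0, 0, 0⟩, ⟨0, 1, 0, 0⟩, ⟨0, 0, 1, 0⟩, ⟨0, 0, 0, 1⟩] i := by
    apply (QuaternionAlgebra.basisOneIJK c₁ c₂ c₃).repr.injective
    ext j
    rw [Basis.repr_self, QuaternionAlgebra.coe_basisOneIJK_repr]
    fin_cases i <;> fin_cases j <;> simp
  rw [LinearMap.trace_eq_matrix_trace ℝ (QuaternionAlgebra.basisOneIJK c₁ c₂ c₃),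
    Matrix.trace, Fin.sum_univ_four]
  simp only [Matrix.diag_apply, LinearMap.toMatrix_apply, hb,
    QuaternionAlgebra.coe_basisOneIJK_repr]
  simp

/-- Over the basis `e = 1, i, j, k`, the trace is `∑ Re(ē a e b)`, and `∑ ē a e = 4 Re a`. -/
theorem trace_quaternionAlgebra_mul_mul {a b : ℍ[ℝ,-1,0,-1]}
    {g : ℍ[ℝ,-1,0,-1] →ₗ[ℝ] ℍ[ℝ,-1,0,-1]} (hg : ∀ x, g x = a * x * b) :
    LinearMap.trace ℝ _ g = 4 * (a.re * b.re) := by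
  rw [trace_quaternionAlgebra]
  simp only [hg, QuaternionAlgebra.re_mul, QuaternionAlgebra.imI_mul, QuaternionAlgebra.imJ_mul,
    QuaternionAlgebra.imK_mul]
  ring

theorem trace_quaternion_mul_mul {g : ℍ →ₗ[ℝ] ℍ} {a b : ℍ} (hg : ∀ x, g x = a * x * b) :
    LinearMap.trace ℝ ℍ g = 4 * (a.re * b.re) :=
  trace_quaternionAlgebra_mul_mul hg

/-- Here the relevant identity is `∑ ē a ē = -2ā`. -/
theorem trace_quaternionAlgebra_mul_star_mul {a b : ℍ[ℝ,-1,0,-1]}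
    {g : ℍ[ℝ,-1,0,-1] →ₗ[ℝ] ℍ[ℝ,-1,0,-1]} (hg : ∀ x, g x = a * star x * b) :
    LinearMap.trace ℝ _ g = -2 * (a * star b).re := by
  rw [trace_quaternionAlgebra]
  simp only [hg, QuaternionAlgebra.re_mul, QuaternionAlgebra.imI_mul, QuaternionAlgebra.imJ_mul,
    QuaternionAlgebra.imK_mul, QuaternionAlgebra.re_star, QuaternionAlgebra.imI_star,
    QuaternionAlgebra.imJ_star, QuaternionAlgebra.imK_star]
  ring

theorem trace_quaternion_mul_star_mul {g : ℍ →ₗ[ℝ] ℍ} {a b : ℍ}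
    (hg : ∀ x, g x = a * star x * b) :
    LinearMap.trace ℝ ℍ g = -2 * (a * star b).re :=
  trace_quaternionAlgebra_mul_star_mul hg

end LinearMap

namespace QuaternionicUnitary

theorem re_sum {ι : Type*} (s : Finset ι) (f : ι → ℍ) : (∑ i ∈ s, f i).re = ∑ i ∈ s, (f i).re := by
  classical
  induction s using Finset.induction_on with
  | empty => simp
  | insert a s ha ih => rw [Finset.sum_insert ha, Finset.sum_insert ha, Quaternion.re_add, ih]

instance : StarModule ℝ ℍ := ⟨fun r q => (Quaternion.star_smul r q).trans (by rw [star_trivial r])⟩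

variable {n : ℕ}

/-- The linear map `X ↦ a X b` on quaternionic matrices. -/
noncomputable def sandwich (a b : Matrix (Fin n) (Fin n) ℍ) :
    Matrix (Fin n) (Fin n) ℍ →ₗ[ℝ] Matrix (Fin n) (Fin n) ℍ :=
  LinearMap.mulRight ℝ b ∘ₗ LinearMap.mulLeft ℝ a

/-- The linear map `X ↦ a X* b` on quaternionic matrices. -/
noncomputable def starSandwich (a b : Matrix (Fin n) (Fin n) ℍ) :
    Matrix (Fin n) (Fin n) ℍ →ₗ[ℝ] Matrix (Fin n) (Fin n) ℍ :=
  sandwich a b ∘ₗ (starLinearEquiv ℝ : Matrix (Fin n) (Fin n) ℍ ≃ₗ⋆[ℝ] _).toLinearMap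

theorem sandwich_apply (a b X : Matrix (Fin n) (Fin n) ℍ) : sandwich a b X = a * X * b := rfl

theorem starSandwich_apply (a b X : Matrix (Fin n) (Fin n) ℍ) :
    starSandwich a b X = a * star X * b := rfl

theorem trace_sandwich (a b : Matrix (Fin n) (Fin n) ℍ) :
    LinearMap.trace ℝ _ (sandwich a b) = 4 * (a.trace.re * b.trace.re) := by
  rw [LinearMap.trace_matrix_eq_sum]
  have h (i j : Fin n) : LinearMap.trace ℝ ℍ (Matrix.entryLinearMap ℝ ℍ i j ∘ₗ sandwich a b ∘ₗ
      Matrix.singleLinearMap ℝ i j) = 4 * ((a i i).re * (b j j).re) := by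
    refine LinearMap.trace_quaternion_mul_mul fun x => ?_
    simp [sandwich_apply, Matrix.mul_apply, Matrix.single_apply, ite_and]
  simp only [h]
  simp only [Matrix.trace, Matrix.diag_apply, re_sum, Finset.sum_mul_sum]
  simp only [Finset.mul_sum]

theorem trace_starSandwich (a b : Matrix (Fin n) (Fin n) ℍ) :
    LinearMap.trace ℝ _ (starSandwich a b) = -2 * (a * star b).trace.re := by
  rw [LinearMap.trace_matrix_eq_sum]
  have h (i j : Fin n) : LinearMap.trace ℝ ℍ (Matrix.entryLinearMap ℝ ℍ i j ∘ₗ starSandwich a b ∘ₗ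
      Matrix.singleLinearMap ℝ i j) = -2 * (a i j * star (b i j)).re := by
    refine LinearMap.trace_quaternion_mul_star_mul fun x => ?_
    simp [starSandwich_apply, Matrix.mul_apply, Matrix.single_apply, ite_and, apply_ite star]
  simp only [h]
  simp only [Matrix.trace, Matrix.diag_apply, re_sum, Matrix.mul_apply,
    Finset.mul_sum, Matrix.star_apply]

end QuaternionicUnitary

/-! ### Transfer of null sets by Fubini -/

section Fubini

/-- If some nonzero σ-finite measure, transported along `f`, does not charge the right translates
of a set, then left-invariant measures do not charge that set either. -/
theorem measure_eq_zero_of_forall_right_translate {G X : Type*} [Group G] [MeasurableSpace G]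
    [MeasurableMul₂ G] (μ : Measure G) [SFinite μ] [μ.IsMulLeftInvariant] [MeasurableSpace X]
    {ν : Measure X} [SFinite ν] (hν : ν ≠ 0) {f : X → G} (hf : Measurable f) {N : Set G}
    (hN : MeasurableSet N) (h : ∀ g, ν {x | f x * g ∈ N} = 0) : μ N = 0 := by
  have hm : MeasurableSet {p : X × G | f p.1 * p.2 ∈ N} :=
    ((hf.comp measurable_fst).mul measurable_snd) hN
  have h0 : (ν.prod μ) {p : X × G | f p.1 * p.2 ∈ N} = 0 := by
    rw [Measure.prod_apply_symm hm]
    simp only [preimage_ofPred_eq, h, lintegral_zero]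
  -- In the other order, left invariance makes every slice have measure `μ N`.
  have h1 : (ν.prod μ) {p : X × G | f p.1 * p.2 ∈ N} = μ N * ν univ := by
    rw [Measure.prod_apply hm]
    have : ∀ x, μ (Prod.mk x ⁻¹' {p : X × G | f p.1 * p.2 ∈ N}) = μ N := fun x =>
      measure_preimage_mul μ (f x) N
    simp only [this, lintegral_const]
  rw [h1] at h0
  exact (mul_eq_zero.1 h0).resolve_right (by simpa using hν)

end Fubini

namespace StarUnitary

/-- Let `π` map pairs of unitary elements onto a group `G`. If the spaces `skewAnticommutant h`
are small, then the image in `G` of the pairs `(xy, xz)` with `x`, `y`, `z` squaring to `±1`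
is null for left-invariant measures. -/
theorem measure_eq_zero_of_forall_exists_mul {R : Type*} [NormedRing R] [StarRing R]
    [NormedAlgebra ℝ R] [StarModule ℝ R] [ContinuousStar R] [FiniteDimensional ℝ R]
    {G : Type*} [Group G] [TopologicalSpace G] [MeasurableSpace G] [BorelSpace G]
    [MeasurableMul₂ G] (μ : Measure G) [SFinite μ] [μ.IsMulLeftInvariant]
    (π : unitary R × unitary R →* G) (hπ : Continuous π) (hπs : Function.Surjective π) {k : ℕ}
    (hk : ∀ h ∈ squareRoots R, finrank ℝ (skewAnticommutant h) ≤ k)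
    (hlt : 3 * k < 2 * finrank ℝ (skewAdjoint.submodule ℝ R))
    {N : Set G} (hN : MeasurableSet N)
    (h : ∀ a b, π (a, b) ∈ N → ∃ x ∈ squareRoots R, ∃ y ∈ squareRoots R, ∃ z ∈ squareRoots R,
      (a : R) = x * y ∧ (b : R) = x * z) : μ N = 0 := by
  borelize ↥(skewAdjoint.submodule ℝ R)
  obtain ⟨B, hB, H⟩ := exists_nhds_hausdorffMeasure_exp_eq_zero hk hlt
  refine measure_eq_zero_of_forall_right_translate μ (ν := (μH[finrank ℝ
    (skewAdjoint.submodule ℝ R × skewAdjoint.submodule ℝ R)]).restrict (interior B)) ?_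
    (f := fun X => π (expSkewAdjoint X.1, expSkewAdjoint X.2))
    (hπ.comp ((continuous_expSkewAdjoint.comp continuous_fst).prodMk
      (continuous_expSkewAdjoint.comp continuous_snd))).measurable hN ?_
  · rw [Ne, Measure.restrict_eq_zero]
    exact (isOpen_interior.measure_pos _ ⟨0, mem_interior_iff_mem_nhds.2 hB⟩).ne'
  · intro g
    obtain ⟨⟨a, b⟩, rfl⟩ := hπs g
    rw [Measure.restrict_apply' isOpen_interior.measurableSet]
    refine measure_mono_null ?_ (H (star (a : R)) (star (b : R)))
    rintro X ⟨hX, hXB⟩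
    refine ⟨interior_subset hXB, ?_⟩
    rw [mem_ofPred_eq, ← map_mul, Prod.mk_mul_mk] at hX
    obtain ⟨x, hx, y, hy, z, hz, h1, h2⟩ := h _ _ hX
    refine ⟨x, hx, y, hy, z, hz, ?_, ?_⟩
    · rw [← h1, Submonoid.coe_mul, mul_assoc, Unitary.mul_star_self_of_mem a.2, mul_one]
    · rw [← h2, Submonoid.coe_mul, mul_assoc, Unitary.mul_star_self_of_mem b.2, mul_one]

end StarUnitary

/-! ### Dimensions as traces of projections -/

namespace QuaternionicUnitary

variable {n : ℕ}

theorem finrank_skewAdjoint_matrix :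
    finrank ℝ (skewAdjoint.submodule ℝ (Matrix (Fin n) (Fin n) ℍ)) = n * (2 * n + 1) := by
  have hproj : LinearMap.IsProj (skewAdjoint.submodule ℝ (Matrix (Fin n) (Fin n) ℍ))
      ((1 / 2 : ℝ) • (sandwich 1 1 - starSandwich 1 1)) := by
    constructor
    · intro X
      change star _ = -_
      simp only [LinearMap.smul_apply, LinearMap.sub_apply, sandwich_apply, starSandwich_apply,
        one_mul, mul_one, star_smul, star_trivial, star_sub, star_star]
      rw [← smul_neg, neg_sub]
    · intro X hX
      have hX' : star X = -X := hX
      simp only [LinearMap.smul_apply, LinearMap.sub_apply, sandwich_apply, starSandwich_apply,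
        one_mul, mul_one, hX']
      module
  have h := hproj.trace
  rw [map_smul, map_sub, trace_sandwich, trace_starSandwich, star_one, mul_one,
    Matrix.trace_one, Fintype.card_fin, Quaternion.re_natCast] at h
  have h' : (finrank ℝ (skewAdjoint.submodule ℝ (Matrix (Fin n) (Fin n) ℍ)) : ℝ)
      = (n * (2 * n + 1) : ℕ) := by
    rw [← h]; push_cast; simp only [smul_eq_mul]; ring
  exact_mod_cast h'

theorem finrank_skewAnticommutant_le {h : Matrix (Fin n) (Fin n) ℍ}
    (hh : h ∈ StarUnitary.squareRoots (Matrix (Fin n) (Fin n) ℍ)) :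
    finrank ℝ (StarUnitary.skewAnticommutant h) ≤ n * (n + 1) := by
  obtain ⟨hu, hs⟩ := hh
  have h1 := Unitary.star_mul_self_of_mem hu
  have h2 := Unitary.mul_star_self_of_mem hu
  have hsq : ∀ Y, h * (h * Y * star h) = Y * h := by
    intro Y
    rcases hs with hs | hs
    · have : star h = h := by
        calc star h = star h * (h * h) := by rw [hs, mul_one]
          _ = h := by rw [← mul_assoc, h1, one_mul]
      rw [this, ← mul_assoc, ← mul_assoc, hs, one_mul]
    · have : star h = -h := by
        calc star h = -(star h * (h * h)) := by rw [hs]; simp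
          _ = -h := by rw [← mul_assoc, h1, one_mul]
      rw [this, ← mul_assoc, ← mul_assoc, hs]; simp
  have hcancel : ∀ Y, h * Y * star h * h = h * Y := by
    intro Y; rw [mul_assoc _ (star h), h1, mul_one]
  -- Composite of the commuting projections `X ↦ (X - X*)/2` and `X ↦ (X - hXh*)/2`.
  have hproj : LinearMap.IsProj (StarUnitary.skewAnticommutant h)
      ((1 / 4 : ℝ) • (sandwich 1 1 - starSandwich 1 1 - sandwich h (star h)
        + starSandwich h (star h))) := by
    constructor
    · intro X
      constructor
      · simp only [LinearMap.smul_apply, LinearMap.sub_apply, LinearMap.add_apply, sandwich_apply,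
          starSandwich_apply, one_mul, mul_one, star_smul, star_trivial, star_sub, star_add,
          star_star, star_mul, ← mul_assoc]
        module
      · simp only [LinearMap.smul_apply, LinearMap.sub_apply, LinearMap.add_apply, sandwich_apply,
          starSandwich_apply, one_mul, mul_one, mul_smul_comm, smul_mul_assoc, mul_sub, mul_add,
          sub_mul, add_mul, hsq, hcancel]
        module
    · rintro X ⟨hX, hX'⟩
      have : h * X * star h = -X := by
        rw [hX', neg_mul, mul_assoc, h2, mul_one]
      simp only [LinearMap.smul_apply, LinearMap.sub_apply, LinearMap.add_apply, sandwich_apply,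
        starSandwich_apply, one_mul, mul_one, hX, mul_neg, neg_mul, this]
      module
  have ht := hproj.trace
  rw [map_smul, map_add, map_sub, map_sub, trace_sandwich, trace_starSandwich, trace_sandwich,
    trace_starSandwich, star_one, mul_one, star_star, Matrix.trace_one, Fintype.card_fin,
    Quaternion.re_natCast] at ht
  have hre : (star h).trace.re = h.trace.re := by
    rw [Matrix.star_eq_conjTranspose, Matrix.trace_conjTranspose, Quaternion.re_star]
  -- The dimension is `n² + n/2 - (Re tr h)² - Re tr(h²)/2`, so the worst case is `h² = -1`.
  have hb : -(n : ℝ) ≤ (h * h).trace.re := by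
    rcases hs with hs | hs <;> rw [hs]
    · rw [Matrix.trace_one, Fintype.card_fin, Quaternion.re_natCast]
      have : (0 : ℝ) ≤ n := n.cast_nonneg
      linarith
    · rw [Matrix.trace_neg, Matrix.trace_one, Fintype.card_fin, Quaternion.re_neg,
        Quaternion.re_natCast]
  have h' : (finrank ℝ (StarUnitary.skewAnticommutant h) : ℝ) ≤ (n * (n + 1) : ℕ) := by
    rw [← ht, hre]; push_cast; simp only [smul_eq_mul]
    nlinarith [mul_self_nonneg h.trace.re]
  exact_mod_cast h'

end QuaternionicUnitary

theorem IsSigmaCompact.measurableSet {X : Type*} [TopologicalSpace X] [T2Space X]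
    [MeasurableSpace X] [BorelSpace X] {s : Set X} (hs : IsSigmaCompact s) : MeasurableSet s := by
  obtain ⟨K, hK, rfl⟩ := hs
  exact MeasurableSet.iUnion fun i => (hK i).measurableSet

/-! ### Application to `PSp(n)` -/

namespace QuaternionicUnitary

attribute [local instance] Matrix.linftyOpNormedRing Matrix.linftyOpNormedAlgebra

variable {n : ℕ}

instance : @ContinuousStar (Matrix (Fin n) (Fin n) ℍ)
    PseudoMetricSpace.toUniformSpace.toTopologicalSpace _ :=
  ⟨continuous_id.matrix_conjTranspose⟩

instance : SigmaCompactSpace (Sp n) := StarUnitary.sigmaCompactSpace_unitary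

/-- The projection `Sp(n) → PSp(n)`. -/
noncomputable def toPSp (n : ℕ) : Sp n →* PSp n := QuotientGroup.mk' (plusMinusOne n)

theorem toPSp_surjective : Function.Surjective (toPSp n) :=
  QuotientGroup.mk'_surjective _

theorem continuous_toPSp : Continuous (toPSp n) :=
  (QuotientGroup.continuous_mk : Continuous (QuotientGroup.mk : Sp n → Sp n ⧸ plusMinusOne n))

theorem toPSp_eq_one_iff {u : Sp n} : toPSp n u = 1 ↔ u = 1 ∨ u = -1 :=
  QuotientGroup.eq_one_iff u

instance : SigmaCompactSpace (PSp n) :=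
  ⟨by
    rw [← toPSp_surjective.range_eq, ← image_univ]
    exact isSigmaCompact_univ.image continuous_toPSp⟩

instance : T2Space (PSp n) := by
  have : IsClosed (plusMinusOne n : Set (Sp n)) := by
    refine Set.Finite.isClosed ((Set.toFinite {1, -1}).subset ?_)
    rintro u (rfl | rfl) <;> simp
  exact inferInstanceAs (T2Space (Sp n ⧸ plusMinusOne n))

/-- The set is the projection of a closed subset of a σ-compact space, hence σ-compact. -/
theorem measurableSet_stronglyDoublyReversible :
    MeasurableSet {g : PSp n × PSp n | IsStronglyDoublyReversible g} := by
  have hC : IsClosed {p : PSp n × (PSp n × PSp n) | p.1 ^ 2 = 1 ∧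
      p.1 * p.2.1 * p.1⁻¹ = p.2.1⁻¹ ∧ p.1 * p.2.2 * p.1⁻¹ = p.2.2⁻¹} :=
    (isClosed_eq (by fun_prop) (by fun_prop)).inter
      ((isClosed_eq (by fun_prop) (by fun_prop)).inter (isClosed_eq (by fun_prop) (by fun_prop)))
  have := ((isSigmaCompact_univ.of_isClosed_subset hC (subset_univ _)).image
    continuous_snd).measurableSet
  convert this using 1
  ext g
  simp [IsStronglyDoublyReversible]

theorem coe_mem_squareRoots {u : Sp n} (hu : toPSp n u * toPSp n u = 1) :
    (u : Matrix (Fin n) (Fin n) ℍ) ∈ StarUnitary.squareRoots (Matrix (Fin n) (Fin n) ℍ) := by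
  rw [← map_mul, toPSp_eq_one_iff] at hu
  refine ⟨u.2, hu.imp (fun h => ?_) (fun h => ?_)⟩
  · exact congrArg Subtype.val h
  · exact congrArg Subtype.val h

/-- A strongly doubly reversible pair lifts to a pair `(xy, xz)` where `x`, `y`, `z` square
to `±1`. -/
theorem exists_eq_mul_of_isStronglyDoublyReversible {a b : Sp n}
    (h : IsStronglyDoublyReversible (toPSp n a, toPSp n b)) :
    ∃ x y z : Sp n, toPSp n x * toPSp n x = 1 ∧ toPSp n y * toPSp n y = 1 ∧
      toPSp n z * toPSp n z = 1 ∧ a = x * y ∧ b = x * z := by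
  obtain ⟨t, ht, ha, hb⟩ := h
  obtain ⟨η, rfl⟩ := toPSp_surjective t
  rw [pow_two] at ht
  have key : ∀ c : Sp n, toPSp n η * toPSp n c * (toPSp n η)⁻¹ = (toPSp n c)⁻¹ →
      toPSp n (η * c) * toPSp n (η * c) = 1 := by
    intro c hc
    have hinv : (toPSp n η)⁻¹ = toPSp n η := inv_eq_of_mul_eq_one_left ht
    rw [hinv] at hc
    rw [map_mul, ← mul_assoc, hc, inv_mul_cancel]
  refine ⟨η⁻¹, η * a, η * b, ?_, key a ha, key b hb, by simp, by simp⟩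
  rw [map_inv, ← mul_inv_rev, ht, inv_one]

theorem measure_stronglyDoublyReversible_eq_zero (hn : 2 ≤ n) (μ : Measure (PSp n × PSp n))
    [μ.IsHaarMeasure] : μ {g : PSp n × PSp n | IsStronglyDoublyReversible g} = 0 := by
  refine StarUnitary.measure_eq_zero_of_forall_exists_mul (R := Matrix (Fin n) (Fin n) ℍ)
    (k := n * (n + 1)) μ ((toPSp n).prodMap (toPSp n)) (continuous_toPSp.prodMap continuous_toPSp)
    (toPSp_surjective.prodMap toPSp_surjective) (fun h hh => finrank_skewAnticommutant_le hh)
    -- `3n(n+1) < 2n(2n+1)` amounts to `n > 1`.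
    (by rw [finrank_skewAdjoint_matrix]; nlinarith) measurableSet_stronglyDoublyReversible ?_
  intro a b hab
  obtain ⟨x, y, z, hx, hy, hz, rfl, rfl⟩ := exists_eq_mul_of_isStronglyDoublyReversible hab
  exact ⟨x, coe_mem_squareRoots hx, y, coe_mem_squareRoots hy, z, coe_mem_squareRoots hz, rfl, rfl⟩

end QuaternionicUnitary

theorem corollary1p2 (n : ℕ) (hn : 2 ≤ n)
    (μ : MeasureTheory.Measure (QuaternionicUnitary.PSp n × QuaternionicUnitary.PSp n))
    [μ.IsHaarMeasure] :
    μ {g : QuaternionicUnitary.PSp n × QuaternionicUnitary.PSp n |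
      QuaternionicUnitary.IsStronglyDoublyReversible g} = 0 :=
  QuaternionicUnitary.measure_stronglyDoublyReversible_eq_zero hn μ
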